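/- Let $n\ge1$, $k\ge0$ and let $A,C\in\mathbb R^{n\times n}$, $B,D\in\mathbb R^{n\times k}$, $L\in\mathbb R^{k\times n}$, $Q\in\mathbb R^{n\times n}$, $R\in\mathbb R^{k\times k}$ be constant real matrices such that the block matrix $\begin{pmatrix}Q&L'\\L&R\end{pmatrix}$ is symmetric positive definite ($'$ denotes the transpose). Write $X\le Y$ if $Y-X$ is symmetric positive semidefinite and $X\gg0$ if $X$ is symmetric positive definite. For $X$ symmetric and $Y\gg0$ put $M(X/Y)=\inf\{t\in\mathbb R: X\le tY\}$ and $m(X/Y)=\sup\{t\in\mathbb R: tY\le X\}$, and for $X,Y\gg0$ let $d_T(X,Y)=\log\max\{M(X/Y),M(Y/X)\}$ be the Thompson metric. For $P\gg0$ let $$\phi(P)=A'P+PA+C'PC+Q-(B'P+D'PC+L)'(R+D'PD)^{-1}(B'P+D'PC+L).$$ The generalized algebraic Riccati equation (GARE) is $\phi(P)=0$, $R+D'PD\gg0$. Then the GARE has a solution $\bar P\gg0$ if and only if there is $P_0\gg0$ with $\phi(P_0)\le0$. In that case the solution $\bar P\gg0$ is unique, and for every $P\gg0$ the generalized Riccati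 differential equation $\dot X=\phi(X)$, $X(0)=P$, considered on the set of positive definite matrices, has a unique solution $M_t(P)$, defined and positive definite for all $t\ge0$ (every solution on an interval $[0,T)$ is a restriction of it), and there is $\alpha>0$, which may depend on $P$, such that $$d_T(M_t(P),\bar P)\le e^{-\alpha t}\,d_T(P,\bar P)\qquad\text{for all }t\ge0,$$ where, if $P\ne\bar P$, $$\alpha\ \ge\ \frac{1-e^{-d_T(P,\bar P)}}{d_T(P,\bar P)}\;m\big((Q-L'R^{-1}L)/\bar P\big)\ >\ 0 .$$ (For $P=\bar P$ the trajectory is constant.) -/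

import Mathlib

open scoped Matrix

noncomputable section

namespace GenRiccati

/-- The (non-strict) Loewner order `X ≤ Y` on real square matrices: `Y - X` is symmetric positive
semidefinite. -/
def LoewnerLE {n : ℕ} (X Y : Matrix (Fin n) (Fin n) ℝ) : Prop :=
  (Y - X).PosSemidef

/-- `M(X/Y) = inf {t ∈ ℝ : X ≤ t Y}` for the cone of positive semidefinite matrices. -/
def bigM {n : ℕ} (X Y : Matrix (Fin n) (Fin n) ℝ) : ℝ :=
  sInf {t : ℝ | LoewnerLE X (t • Y)}

/-- `m(X/Y) = sup {t ∈ ℝ : X ≥ t Y}` for the cone of positive semidefinite matrices. -/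
def smallM {n : ℕ} (X Y : Matrix (Fin n) (Fin n) ℝ) : ℝ :=
  sSup {t : ℝ | LoewnerLE (t • Y) X}

/-- Thompson's part metric `log max {M(X/Y), M(Y/X)}` (used on positive definite matrices). -/
def dT {n : ℕ} (X Y : Matrix (Fin n) (Fin n) ℝ) : ℝ :=
  Real.log (max (bigM X Y) (bigM Y X))

/-- Constant coefficients of the generalized Riccati equation, state dimension `n`, control
dimension `k`. -/
structure Coeffs (n k : ℕ) where
  A : Matrix (Fin n) (Fin n) ℝ
  B : Matrix (Fin n) (Fin k) ℝ
  C : Matrix (Fin n) (Fin n) ℝ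
  D : Matrix (Fin n) (Fin k) ℝ
  L : Matrix (Fin k) (Fin n) ℝ
  Q : Matrix (Fin n) (Fin n) ℝ
  R : Matrix (Fin k) (Fin k) ℝ

namespace Coeffs

variable {n k : ℕ} (S : Coeffs n k)

/-- The block matrix `[[Q, L'], [L, R]]`. -/
def weight : Matrix (Fin n ⊕ Fin k) (Fin n ⊕ Fin k) ℝ :=
  Matrix.fromBlocks S.Q S.Lᵀ S.L S.R

/-- The right-hand side of the generalized Riccati equation. -/
def phi (P : Matrix (Fin n) (Fin n) ℝ) : Matrix (Fin n) (Fin n) ℝ :=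
  S.Aᵀ * P + P * S.A + S.Cᵀ * P * S.C + S.Q
    - (S.Bᵀ * P + S.Dᵀ * P * S.C + S.L)ᵀ * (S.R + S.Dᵀ * P * S.D)⁻¹
      * (S.Bᵀ * P + S.Dᵀ * P * S.C + S.L)

/-- The generalized algebraic Riccati equation. -/
def GARE (P : Matrix (Fin n) (Fin n) ℝ) : Prop :=
  S.phi P = 0 ∧ (S.R + S.Dᵀ * P * S.D).PosDef

/-- `X` restricted to `[0, T)` is a solution, with values in the positive definite matrices, of the
initial value problem `X' = φ(X)`, `X(0) = P`. At `t = 0` the derivative is the right derivative. -/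
def IsSolution (P : Matrix (Fin n) (Fin n) ℝ) (T : EReal)
    (X : ℝ → Matrix (Fin n) (Fin n) ℝ) : Prop :=
  X 0 = P ∧ ∀ t : ℝ, 0 ≤ t → (t : EReal) < T →
    (X t).PosDef ∧ HasDerivWithinAt X (S.phi (X t)) (Set.Ici 0) t

/-- `X` is the trajectory `t ↦ M_t(P)`, `t ≥ 0`, of the flow on the positive definite matrices:
it solves the initial value problem for all times, and every solution on some `[0, T)` is a
restriction of it. -/
def IsTrajectory (P : Matrix (Fin n) (Fin n) ℝ) (X : ℝ → Matrix (Fin n) (Fin n) ℝ) : Prop :=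
  S.IsSolution P ⊤ X ∧
    ∀ (T : EReal) (Y : ℝ → Matrix (Fin n) (Fin n) ℝ), S.IsSolution P T Y →
      ∀ t : ℝ, 0 ≤ t → (t : EReal) < T → Y t = X t

/-- `((1 - e^{-d}) / d) * m((Q - L' R⁻¹ L) / P̄)` with `d = d_T(P, P̄)`, meaningful for
`P ≠ P̄`. -/
def rate (P Pbar : Matrix (Fin n) (Fin n) ℝ) : ℝ :=
  (1 - Real.exp (-dT P Pbar)) / dT P Pbar * smallM (S.Q - S.Lᵀ * S.R⁻¹ * S.L) Pbar

end Coeffs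

end GenRiccati

end

/-!
For every feedback `K`, completing the square gives `φ(P) ≤ lyap K P + cost K`, with equality at the
optimal gain, so `φ` is a minimum of affine maps with coefficients `lyap K` and `cost K`. Along the
difference `Z = V - U` of two solutions this yields `Z' ≥ lyap K Z` with `K` the gain at `V`, and
the cone of positive semidefinite matrices is invariant under that inequality because
`v'(lyap K Z)v ≥ 0` whenever `Z ≥ 0` and `Zv = 0`. Hence sub- and supersolutions are ordered by
their initial values, and order intervals between a constant subsolution and a constant
supersolution are invariant compact sets.

If `φ(P₀) ≤ 0`, the solution from `P₀` decreases and preserves `φ ≤ 0`, so a minimizer of the trace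
over `{X ∈ [a P₀, P₀] : φ(X) ≤ 0}` is stationary; here `a` is so small that `φ(a P₀) ≥ 0`.

For the contraction, every cost dominates the Schur complement `Q - L'R⁻¹L ≥ m P̄`, where
`m = m((Q - L'R⁻¹L)/P̄)`, so `φ(a P̄) ≤ -(a - 1) m P̄` for `a ≥ 1` and `φ(a P̄) ≥ (1 - a) m P̄` for
`0 ≤ a ≤ 1`. Therefore `e^{l(t)} P̄` and `e^{-l(t)} P̄` are a super- and a subsolution as soon as
`l' ≥ -(1 - e^{-l}) m`, which `l(t) = d e^{-αt}` satisfies because `s ↦ 1 - e^{-s}` is concave.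
-/

namespace GenRiccati

open Filter Set Topology
open scoped MatrixOrder Matrix.Norms.L2Operator

noncomputable section

section LoewnerOrder

variable {ι κ : Type*}

theorem posDef_of_le {X Y : Matrix ι ι ℝ} (hX : X.PosDef) (h : X ≤ Y) : Y.PosDef := by
  simpa using hX.add_posSemidef (Matrix.le_iff.1 h)

theorem transpose_mul_mul_nonneg [Fintype ι] [Finite κ] {P : Matrix ι ι ℝ} (hP : 0 ≤ P)
    (V : Matrix ι κ ℝ) : 0 ≤ Vᵀ * P * V := by
  cases nonempty_fintype κ
  rw [Matrix.nonneg_iff_posSemidef] at *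
  exact hP.conjTranspose_mul_mul_same V

theorem dotProduct_mulVec_mono [Fintype ι] {X Y : Matrix ι ι ℝ} (h : X ≤ Y) (v : ι → ℝ) :
    v ⬝ᵥ X *ᵥ v ≤ v ⬝ᵥ Y *ᵥ v := by
  simpa [Matrix.sub_mulVec, dotProduct_sub] using (Matrix.le_iff.1 h).dotProduct_mulVec_nonneg v

theorem le_norm_smul_one [Fintype ι] [DecidableEq ι] {X : Matrix ι ι ℝ} (hX : X.IsHermitian) :
    X ≤ ‖X‖ • 1 := by
  rw [← Algebra.algebraMap_eq_smul_one]
  exact le_algebraMap_of_spectrum_le (fun x hx => (le_abs_self x).trans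
    (IsometricContinuousFunctionalCalculus.norm_spectrum_le X hx hX)) hX

theorem norm_le_norm_of_nonneg_of_le [Fintype ι] [DecidableEq ι] {X Y : Matrix ι ι ℝ}
    (hX : 0 ≤ X) (h : X ≤ Y) : ‖X‖ ≤ ‖Y‖ := by
  have hle : X ≤ algebraMap ℝ _ ‖Y‖ := by
    rw [Algebra.algebraMap_eq_smul_one]
    exact h.trans (le_norm_smul_one (IsSelfAdjoint.of_nonneg (hX.trans h)))
  have hXsa : IsSelfAdjoint X := .of_nonneg hX
  rw [← cfc_id ℝ X]
  refine norm_cfc_le (norm_nonneg _) fun x hx => ?_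
  rw [id, Real.norm_of_nonneg (spectrum_nonneg_of_nonneg hX hx)]
  exact (le_algebraMap_iff_spectrum_le (R := ℝ) (ha := hXsa)).1 hle x hx

theorem exists_pos_smul_one_le [Finite ι] [DecidableEq ι] {P : Matrix ι ι ℝ} (hP : P.PosDef) :
    ∃ c : ℝ, 0 < c ∧ c • 1 ≤ P := by
  cases nonempty_fintype ι
  cases isEmpty_or_nonempty ι
  · exact ⟨1, one_pos, (Subsingleton.elim _ _).le⟩
  · simp only [← Algebra.algebraMap_eq_smul_one]
    exact (CFC.exists_pos_algebraMap_le_iff (A := Matrix ι ι ℝ) (a := P) hP.1).2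
      fun x hx => hP.isStrictlyPositive.spectrum_pos hx

variable [Finite ι]

theorem exists_pos_le_smul {X Y : Matrix ι ι ℝ} (hX : X.IsHermitian) (hY : Y.PosDef) :
    ∃ t : ℝ, 0 < t ∧ X ≤ t • Y := by
  classical
  cases nonempty_fintype ι
  obtain ⟨c, hc, hcY⟩ := exists_pos_smul_one_le hY
  refine ⟨(‖X‖ + 1) / c, by positivity, ?_⟩
  calc X ≤ ‖X‖ • 1 := le_norm_smul_one hX
    _ ≤ (‖X‖ + 1) • 1 := smul_le_smul_of_nonneg_right (by linarith) zero_le_one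
    _ = ((‖X‖ + 1) / c) • c • 1 := by rw [smul_smul, div_mul_cancel₀ _ hc.ne']
    _ ≤ ((‖X‖ + 1) / c) • Y := smul_le_smul_of_nonneg_left hcY (by positivity)

theorem isClosed_nonneg : IsClosed {X : Matrix ι ι ℝ | 0 ≤ X} := by
  cases nonempty_fintype ι
  simp only [Matrix.nonneg_iff_posSemidef, Matrix.posSemidef_iff_dotProduct_mulVec, ofPred_and,
    ofPred_forall]
  exact (isClosed_eq continuous_star continuous_id).inter <| isClosed_iInter fun v =>
    isClosed_le continuous_const (by fun_prop)

instance instOrderClosedTopology : OrderClosedTopology (Matrix ι ι ℝ) where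
  isClosed_le' := isClosed_le_of_isClosed_nonneg isClosed_nonneg

instance instCompactIccSpace : CompactIccSpace (Matrix ι ι ℝ) where
  isCompact_Icc := by
    classical
    cases nonempty_fintype ι
    intro P Q
    refine (isCompact_closedBall P ‖Q - P‖).of_isClosed_subset isClosed_Icc fun X hX => ?_
    rw [mem_closedBall_iff_norm]
    exact norm_le_norm_of_nonneg_of_le (sub_nonneg.2 hX.1) (sub_le_sub_right hX.2 P)

end LoewnerOrder

section SymmetricPart

variable {ι : Type*}

/-- The symmetric part of a square matrix. Requiring only the symmetric part to be positive definite
turns the positive definite cone into an open subset of the space of all matrices. -/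
def symmPart (X : Matrix ι ι ℝ) : Matrix ι ι ℝ := (2⁻¹ : ℝ) • (X + star X)

theorem symmPart_eq_self {X : Matrix ι ι ℝ} (hX : X.IsHermitian) : symmPart X = X := by
  rw [symmPart, Matrix.star_eq_conjTranspose, hX.eq, ← two_smul ℝ X, inv_smul_smul₀ two_ne_zero]

theorem isHermitian_symmPart (X : Matrix ι ι ℝ) : (symmPart X).IsHermitian :=
  (IsSelfAdjoint.all (2⁻¹ : ℝ)).smul (.add_star_self X)

theorem contDiff_symmPart [Fintype ι] [DecidableEq ι] {m : WithTop ℕ∞} :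
    ContDiff ℝ m (symmPart : Matrix ι ι ℝ → Matrix ι ι ℝ) :=
  (contDiff_id.add (starL' ℝ : Matrix ι ι ℝ ≃L[ℝ] Matrix ι ι ℝ).contDiff).const_smul _

theorem isOpen_posDef_symmPart [Finite ι] :
    IsOpen {X : Matrix ι ι ℝ | (symmPart X).PosDef} := by
  classical
  cases nonempty_fintype ι
  refine isOpen_iff_mem_nhds.2 fun P hP => ?_
  obtain ⟨c, hc, hcP⟩ := exists_pos_smul_one_le hP
  have hcont : Continuous fun X => ‖symmPart P - symmPart X‖ :=
    (continuous_const.sub (contDiff_symmPart (m := 0)).continuous).norm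
  filter_upwards [hcont.continuousAt.eventually_lt_const (by simpa using hc)] with X hX
  have hle := le_norm_smul_one ((isHermitian_symmPart P).sub (isHermitian_symmPart X))
  refine posDef_of_le (Matrix.PosDef.one.smul (sub_pos.2 hX)) ?_
  rw [sub_smul, sub_le_comm]
  exact (sub_le_sub_right hcP _).trans hle

end SymmetricPart

section FirstExit

variable {ι : Type*} [Fintype ι]

theorem hasDerivWithinAt_dotProduct_mulVec {X : ℝ → Matrix ι ι ℝ} {X' : Matrix ι ι ℝ} {s : Set ℝ}
    {t : ℝ} (h : HasDerivWithinAt X X' s t) (v : ι → ℝ) :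
    HasDerivWithinAt (fun r => v ⬝ᵥ X r *ᵥ v) (v ⬝ᵥ X' *ᵥ v) s t := by
  classical
  let q : Matrix ι ι ℝ →ₗ[ℝ] ℝ := IsLinearMap.mk' (fun X => v ⬝ᵥ X *ᵥ v)
    { map_add := fun X Y => by simp [Matrix.add_mulVec, dotProduct_add]
      map_smul := fun c X => by simp [Matrix.smul_mulVec] }
  exact q.toContinuousLinearMap.hasFDerivAt.comp_hasDerivWithinAt t h

theorem deriv_nonpos_of_left_le {g : ℝ → ℝ} {g' T t : ℝ} (ht : t ∈ Ioc 0 T)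
    (hg : HasDerivWithinAt g g' (Icc 0 T) t) (h : ∀ s ∈ Ico 0 t, g t ≤ g s) : g' ≤ 0 := by
  replace hg := hg.mono (Ico_subset_Icc_self.trans (Icc_subset_Icc_right ht.2))
  rw [hasDerivWithinAt_iff_tendsto_slope' right_notMem_Ico] at hg
  have : (𝓝[Ico 0 t] t).NeBot := right_nhdsWithin_Ico_neBot ht.1
  refine le_of_tendsto hg (eventually_nhdsWithin_of_forall fun s hs => ?_)
  rw [slope_def_field]
  exact div_nonpos_of_nonneg_of_nonpos (sub_nonneg.2 (h s hs)) (sub_nonpos.2 hs.2.le)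

theorem posDef_of_deriv_pos_on_ker {T : ℝ} {W W' : ℝ → Matrix ι ι ℝ}
    (hherm : ∀ t ∈ Icc 0 T, (W t).IsHermitian) (h0 : (W 0).PosDef)
    (hW : ∀ t ∈ Icc 0 T, HasDerivWithinAt W (W' t) (Icc 0 T) t)
    (hker : ∀ t ∈ Icc 0 T, 0 ≤ W t → ∀ v ≠ 0, W t *ᵥ v = 0 → 0 < v ⬝ᵥ W' t *ᵥ v) :
    ∀ t ∈ Icc 0 T, (W t).PosDef := by
  classical
  have hcont : ContinuousOn W (Icc 0 T) := fun t ht => (hW t ht).continuousWithinAt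
  let bad := {t ∈ Icc 0 T | ¬(W t).PosDef}
  have hbad : IsCompact bad := by
    have : bad = Icc 0 T ∩ W ⁻¹' {X | (symmPart X).PosDef}ᶜ := by
      ext t
      exact and_congr_right fun ht => not_congr (by rw [mem_ofPred, symmPart_eq_self (hherm t ht)])
    exact this ▸ isCompact_Icc.of_isClosed_subset (hcont.preimage_isClosed_of_isClosed isClosed_Icc
      isOpen_posDef_symmPart.isClosed_compl) inter_subset_left
  by_contra! ⟨t, ht, htW⟩
  obtain ⟨τ, ⟨hτ, hτbad⟩, hmin⟩ := hbad.exists_isLeast ⟨t, ht, htW⟩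
  have hτ0 : 0 < τ := hτ.1.lt_of_ne (by rintro rfl; exact hτbad h0)
  have hsub : Ico 0 τ ⊆ Icc 0 T := Ico_subset_Icc_self.trans (Icc_subset_Icc_right hτ.2)
  have hbefore : ∀ s ∈ Ico 0 τ, 0 ≤ W s := fun s hs => Matrix.nonneg_iff_posSemidef.2 <|
    Matrix.PosDef.posSemidef <| not_not.1 fun hn => (hmin ⟨hsub hs, hn⟩).not_gt hs.2
  have : (𝓝[Ico 0 τ] τ).NeBot := right_nhdsWithin_Ico_neBot hτ0
  have hnonneg : 0 ≤ W τ := ge_of_tendsto ((hcont τ hτ).mono hsub)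
    (eventually_nhdsWithin_of_forall hbefore)
  obtain ⟨v, hv, hWv⟩ : ∃ v ≠ 0, W τ *ᵥ v = 0 := by
    rwa [Matrix.exists_mulVec_eq_zero_iff, ← not_ne_iff,
      ← (Matrix.nonneg_iff_posSemidef.1 hnonneg).posDef_iff_det_ne_zero]
  refine (hker τ hτ hnonneg v hv hWv).not_ge (deriv_nonpos_of_left_le ⟨hτ0, hτ.2⟩
    (hasDerivWithinAt_dotProduct_mulVec (hW τ hτ) v) fun s hs => ?_)
  simpa [hWv] using dotProduct_mulVec_mono (hbefore s hs) v

end FirstExit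

theorem complete_square {R ι κ : Type*} [CommRing R] [Fintype κ] [DecidableEq κ] {G : Matrix κ κ R}
    (hG : G.IsSymm) (hdet : IsUnit G.det) (N K : Matrix κ ι R) :
    (K + G⁻¹ * N)ᵀ * G * (K + G⁻¹ * N) = Kᵀ * N + Nᵀ * K + Kᵀ * G * K + Nᵀ * G⁻¹ * N := by
  have hright : G * (K + G⁻¹ * N) = G * K + N := by
    rw [Matrix.mul_add, Matrix.mul_nonsing_inv_cancel_left _ _ hdet]
  rw [Matrix.mul_assoc, hright, Matrix.transpose_add, Matrix.transpose_mul,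
    Matrix.transpose_nonsing_inv, hG.eq]
  simp only [Matrix.add_mul, Matrix.mul_add, Matrix.mul_assoc,
    Matrix.nonsing_inv_mul_cancel_left _ _ hdet]
  abel

namespace Coeffs

variable {n k : ℕ} (S : Coeffs n k)

/-- The matrix `R + D'PD` inverted in the Riccati equation. -/
def denom (P : Matrix (Fin n) (Fin n) ℝ) : Matrix (Fin k) (Fin k) ℝ := S.R + S.Dᵀ * P * S.D

/-- The matrix `B'P + D'PC + L`. -/
def cross (P : Matrix (Fin n) (Fin n) ℝ) : Matrix (Fin k) (Fin n) ℝ :=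
  S.Bᵀ * P + S.Dᵀ * P * S.C + S.L

/-- The optimal feedback gain `-(R + D'PD)⁻¹(B'P + D'PC + L)`. -/
def gain (P : Matrix (Fin n) (Fin n) ℝ) : Matrix (Fin k) (Fin n) ℝ := -((S.denom P)⁻¹ * S.cross P)

/-- The generalized Lyapunov operator of the system closed by the feedback `K`. -/
def lyap (K : Matrix (Fin k) (Fin n) ℝ) : Matrix (Fin n) (Fin n) ℝ →ₗ[ℝ] Matrix (Fin n) (Fin n) ℝ :=
  LinearMap.mulLeft ℝ (S.A + S.B * K)ᵀ + LinearMap.mulRight ℝ (S.A + S.B * K) +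
    LinearMap.mulLeftRight ℝ ((S.C + S.D * K)ᵀ, S.C + S.D * K)

/-- The running cost matrix of the feedback `K`. -/
def cost (K : Matrix (Fin k) (Fin n) ℝ) : Matrix (Fin n) (Fin n) ℝ :=
  S.Q + S.Lᵀ * K + Kᵀ * S.L + Kᵀ * S.R * K

/-- The Schur complement `Q - L'R⁻¹L` of `R` in the weight matrix. -/
def schur : Matrix (Fin n) (Fin n) ℝ := S.Q - S.Lᵀ * S.R⁻¹ * S.L

variable {S}

theorem lyap_apply (K : Matrix (Fin k) (Fin n) ℝ) (P : Matrix (Fin n) (Fin n) ℝ) :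
    S.lyap K P = (S.A + S.B * K)ᵀ * P + P * (S.A + S.B * K) +
      (S.C + S.D * K)ᵀ * P * (S.C + S.D * K) := rfl

theorem isHermitian_lyap (K : Matrix (Fin k) (Fin n) ℝ) {P : Matrix (Fin n) (Fin n) ℝ}
    (hP : P.IsHermitian) : (S.lyap K P).IsHermitian := by
  have hPT : Pᵀ = P := hP
  rw [Matrix.isHermitian_iff_isSymm, Matrix.IsSymm, lyap_apply]
  simp only [Matrix.transpose_add, Matrix.transpose_mul, Matrix.transpose_transpose, hPT,
    Matrix.mul_assoc]
  abel

theorem continuous_lyap (P : Matrix (Fin n) (Fin n) ℝ) : Continuous fun K => S.lyap K P := by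
  simp only [lyap_apply]
  fun_prop

theorem dotProduct_lyap_nonneg (K : Matrix (Fin k) (Fin n) ℝ) {Z : Matrix (Fin n) (Fin n) ℝ}
    (hZ : 0 ≤ Z) {v : Fin n → ℝ} (hv : Z *ᵥ v = 0) : 0 ≤ v ⬝ᵥ S.lyap K Z *ᵥ v := by
  have hvZ : v ᵥ* Z = 0 := by
    rw [← Matrix.mulVec_transpose, ← Matrix.conjTranspose_eq_transpose_of_trivial,
      (Matrix.nonneg_iff_posSemidef.1 hZ).1.eq, hv]
  have h : v ⬝ᵥ S.lyap K Z *ᵥ v = v ⬝ᵥ ((S.C + S.D * K)ᵀ * Z * (S.C + S.D * K)) *ᵥ v := by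
    simp [lyap_apply, Matrix.add_mulVec, dotProduct_add, ← Matrix.mulVec_mulVec, hv,
      Matrix.dotProduct_mulVec v Z, hvZ]
  rw [h]
  simpa using dotProduct_mulVec_mono (transpose_mul_mul_nonneg hZ (S.C + S.D * K)) v

theorem cost_eq (K : Matrix (Fin k) (Fin n) ℝ) :
    S.cost K = (Matrix.fromRows (1 : Matrix (Fin n) (Fin n) ℝ) K)ᵀ * S.weight *
      Matrix.fromRows (1 : Matrix (Fin n) (Fin n) ℝ) K := by
  rw [weight, Matrix.mul_assoc, Matrix.fromBlocks_mul_fromRows, Matrix.transpose_fromRows,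
    Matrix.fromCols_mul_fromRows]
  simp only [cost, Matrix.mul_one, Matrix.transpose_one, Matrix.one_mul, Matrix.mul_add,
    Matrix.mul_assoc]
  abel

section Weight

variable (hS : S.weight.PosDef)
include hS

theorem isHermitian_Q : S.Q.IsHermitian := hS.1.submatrix Sum.inl

theorem posDef_R : S.R.PosDef := hS.submatrix Sum.inr_injective

theorem posDef_denom {P : Matrix (Fin n) (Fin n) ℝ} (hP : 0 ≤ P) : (S.denom P).PosDef :=
  posDef_of_le (posDef_R hS) (le_add_of_nonneg_right (transpose_mul_mul_nonneg hP S.D))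

theorem posDef_cost (K : Matrix (Fin k) (Fin n) ℝ) : (S.cost K).PosDef := by
  rw [cost_eq, ← Matrix.conjTranspose_eq_transpose_of_trivial]
  refine hS.conjTranspose_mul_mul_same fun v w h => ?_
  simpa [Matrix.fromRows_mulVec] using congrArg (· ∘ Sum.inl) h

theorem cost_eq_schur_add (K : Matrix (Fin k) (Fin n) ℝ) :
    S.cost K = S.schur + (K + S.R⁻¹ * S.L)ᵀ * S.R * (K + S.R⁻¹ * S.L) := by
  rw [complete_square (Matrix.isHermitian_iff_isSymm.1 (posDef_R hS).1)
    (posDef_R hS).det_pos.ne'.isUnit, cost, schur]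
  abel

theorem schur_le_cost (K : Matrix (Fin k) (Fin n) ℝ) : S.schur ≤ S.cost K := by
  rw [cost_eq_schur_add hS]
  exact le_add_of_nonneg_right (transpose_mul_mul_nonneg (posDef_R hS).posSemidef.nonneg _)

theorem posDef_schur : S.schur.PosDef := by
  simpa [cost_eq_schur_add hS] using posDef_cost hS (-(S.R⁻¹ * S.L))

theorem isHermitian_phi {P : Matrix (Fin n) (Fin n) ℝ} (hP : P.IsHermitian) :
    (S.phi P).IsHermitian := by
  have hQ : S.Qᵀ = S.Q := isHermitian_Q hS
  have hR : S.Rᵀ = S.R := (posDef_R hS).1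
  have hPT : Pᵀ = P := hP
  rw [Matrix.isHermitian_iff_isSymm, Matrix.IsSymm]
  simp only [phi, Matrix.transpose_add, Matrix.transpose_sub, Matrix.transpose_mul, hPT,
    Matrix.transpose_transpose, Matrix.transpose_nonsing_inv, hQ, hR, Matrix.mul_assoc]
  abel

variable {P : Matrix (Fin n) (Fin n) ℝ} (hP : 0 ≤ P)
include hP

theorem lyap_add_cost_eq_phi_add (K : Matrix (Fin k) (Fin n) ℝ) :
    S.lyap K P + S.cost K = S.phi P + (K - S.gain P)ᵀ * S.denom P * (K - S.gain P) := by
  have hPT : Pᵀ = P := (Matrix.nonneg_iff_posSemidef.1 hP).1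
  rw [gain, sub_neg_eq_add, complete_square (Matrix.isHermitian_iff_isSymm.1 (posDef_denom hS hP).1)
    (posDef_denom hS hP).det_pos.ne'.isUnit]
  simp only [lyap_apply, cost, phi, denom, cross, Matrix.transpose_add, Matrix.transpose_mul,
    Matrix.transpose_transpose, Matrix.add_mul, Matrix.mul_add, Matrix.mul_assoc, hPT]
  abel

theorem phi_eq_lyap_gain_add_cost : S.phi P = S.lyap (S.gain P) P + S.cost (S.gain P) := by
  simp [lyap_add_cost_eq_phi_add hS hP]

theorem phi_le_lyap_add_cost (K : Matrix (Fin k) (Fin n) ℝ) : S.phi P ≤ S.lyap K P + S.cost K := by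
  rw [lyap_add_cost_eq_phi_add hS hP]
  exact le_add_of_nonneg_right (transpose_mul_mul_nonneg (posDef_denom hS hP).posSemidef.nonneg _)

theorem smul_phi_add_smul_schur_le {a : ℝ} (h0 : 0 ≤ a) (h1 : a ≤ 1) :
    a • S.phi P + (1 - a) • S.schur ≤ S.phi (a • P) := by
  set K := S.gain (a • P)
  calc a • S.phi P + (1 - a) • S.schur
      ≤ a • (S.lyap K P + S.cost K) + (1 - a) • S.cost K :=
        add_le_add (smul_le_smul_of_nonneg_left (phi_le_lyap_add_cost hS hP K) h0)
          (smul_le_smul_of_nonneg_left (schur_le_cost hS K) (sub_nonneg.2 h1))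
    _ = S.lyap K (a • P) + S.cost K := by rw [map_smul]; module
    _ = S.phi (a • P) := (phi_eq_lyap_gain_add_cost hS (smul_nonneg h0 hP)).symm

theorem phi_smul_le {a : ℝ} (h1 : 1 ≤ a) :
    S.phi (a • P) ≤ a • S.phi P - (a - 1) • S.schur := by
  set K := S.gain P
  calc S.phi (a • P) ≤ S.lyap K (a • P) + S.cost K :=
        phi_le_lyap_add_cost hS (smul_nonneg (zero_le_one.trans h1) hP) K
    _ = a • (S.lyap K P + S.cost K) - (a - 1) • S.cost K := by rw [map_smul]; module
    _ ≤ a • S.phi P - (a - 1) • S.schur := by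
        rw [← phi_eq_lyap_gain_add_cost hS hP]
        exact sub_le_sub_left
          (smul_le_smul_of_nonneg_left (schur_le_cost hS K) (sub_nonneg.2 h1)) _

end Weight

end Coeffs

section Smoothness

variable {E : Type*} [NormedAddCommGroup E] [NormedSpace ℝ E] {m : WithTop ℕ∞} {x : E}

theorem contDiffAt_matrix_mul {ι κ μ : Type*} [Fintype ι] [Fintype κ] [DecidableEq κ] [Fintype μ]
    [DecidableEq μ] {f : E → Matrix ι κ ℝ} {g : E → Matrix κ μ ℝ}
    (hf : ContDiffAt ℝ m f x) (hg : ContDiffAt ℝ m g x) :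
    ContDiffAt ℝ m (fun y => f y * g y) x := by
  let mul : Matrix ι κ ℝ →L[ℝ] Matrix κ μ ℝ →L[ℝ] Matrix ι μ ℝ :=
    (mulLinearMap ℝ).toContinuousBilinearMap
  exact (mul.contDiff.contDiffAt.comp x hf).clm_apply hg

theorem contDiffAt_matrix_inv {κ : Type*} [Fintype κ] [DecidableEq κ] {f : E → Matrix κ κ ℝ}
    (hf : ContDiffAt ℝ m f x) (hx : (f x).PosDef) : ContDiffAt ℝ m (fun y => (f y)⁻¹) x := by
  simp only [Matrix.nonsing_inv_eq_ringInverse]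
  exact (contDiffAt_ringInverse ℝ hx.isUnit.unit).comp x hf

end Smoothness

namespace Coeffs

variable {n k : ℕ} {S : Coeffs n k} {P : Matrix (Fin n) (Fin n) ℝ} {m : WithTop ℕ∞}

theorem contDiffAt_cross : ContDiffAt ℝ m S.cross P :=
  ((contDiffAt_matrix_mul contDiffAt_const contDiffAt_id).add (contDiffAt_matrix_mul
    (contDiffAt_matrix_mul contDiffAt_const contDiffAt_id) contDiffAt_const)).add contDiffAt_const

theorem contDiffAt_gain (hS : S.weight.PosDef) (hP : 0 ≤ P) : ContDiffAt ℝ m S.gain P :=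
  (contDiffAt_matrix_mul (contDiffAt_matrix_inv (contDiffAt_const.add (contDiffAt_matrix_mul
    (contDiffAt_matrix_mul contDiffAt_const contDiffAt_id) contDiffAt_const))
    (posDef_denom hS hP)) contDiffAt_cross).neg

theorem contDiffAt_phi (hS : S.weight.PosDef) (hP : 0 ≤ P) : ContDiffAt ℝ m S.phi P := by
  have hphi : S.phi = fun P => S.lyap 0 P + S.Q + (S.cross P)ᵀ * S.gain P := by
    ext1 P
    simp only [phi, lyap_apply, gain, cross, denom, Matrix.mul_zero, add_zero, Matrix.mul_neg,
      ← sub_eq_add_neg, Matrix.mul_assoc]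
  rw [hphi]
  exact (((S.lyap 0).toContinuousLinearMap.contDiff.contDiffAt).add contDiffAt_const).add
    (contDiffAt_matrix_mul ((Matrix.transposeLinearEquiv (Fin k) (Fin n) ℝ
      ℝ).toContinuousLinearEquiv.contDiff.contDiffAt.comp P contDiffAt_cross)
      (contDiffAt_gain hS hP))

theorem posDef_of_lyap_add_smul_one_le_deriv {T : ℝ} {K : ℝ → Matrix (Fin k) (Fin n) ℝ}
    {W W' : ℝ → Matrix (Fin n) (Fin n) ℝ} {e : ℝ → ℝ} (he : ∀ t ∈ Icc 0 T, 0 < e t)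
    (hherm : ∀ t ∈ Icc 0 T, (W t).IsHermitian) (h0 : (W 0).PosDef)
    (hW : ∀ t ∈ Icc 0 T, HasDerivWithinAt W (W' t) (Icc 0 T) t)
    (hle : ∀ t ∈ Icc 0 T, S.lyap (K t) (W t) + e t • 1 ≤ W' t) : ∀ t ∈ Icc 0 T, (W t).PosDef := by
  refine posDef_of_deriv_pos_on_ker hherm h0 hW fun t ht hWt v hv hWv => ?_
  calc 0 < e t * v ⬝ᵥ v := mul_pos (he t ht) (Matrix.dotProduct_self_star_pos_iff.2 hv)
    _ ≤ v ⬝ᵥ S.lyap (K t) (W t) *ᵥ v + e t * v ⬝ᵥ v :=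
        le_add_of_nonneg_left (dotProduct_lyap_nonneg (K t) hWt hWv)
    _ = v ⬝ᵥ (S.lyap (K t) (W t) + e t • 1) *ᵥ v := by
        rw [Matrix.add_mulVec, Matrix.smul_mulVec, Matrix.one_mulVec, dotProduct_add,
          dotProduct_smul, smul_eq_mul]
    _ ≤ v ⬝ᵥ W' t *ᵥ v := dotProduct_mulVec_mono (hle t ht) v

theorem nonneg_of_lyap_le_deriv {T : ℝ} {K : ℝ → Matrix (Fin k) (Fin n) ℝ}
    {Z Z' : ℝ → Matrix (Fin n) (Fin n) ℝ} (hK : ContinuousOn K (Icc 0 T))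
    (hherm : ∀ t ∈ Icc 0 T, (Z t).IsHermitian) (h0 : 0 ≤ Z 0)
    (hZ : ∀ t ∈ Icc 0 T, HasDerivWithinAt Z (Z' t) (Icc 0 T) t)
    (hle : ∀ t ∈ Icc 0 T, S.lyap (K t) (Z t) ≤ Z' t) : ∀ t ∈ Icc 0 T, 0 ≤ Z t := by
  have hone : (1 : Matrix (Fin n) (Fin n) ℝ).IsHermitian := Matrix.isHermitian_one
  obtain ⟨c, hc⟩ := isCompact_Icc.exists_bound_of_continuousOn
    ((S.continuous_lyap 1).comp_continuousOn hK)
  have hlyap : ∀ t ∈ Icc 0 T, S.lyap (K t) 1 ≤ c • 1 := fun t ht =>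
    (le_norm_smul_one (isHermitian_lyap _ hone)).trans
      (smul_le_smul_of_nonneg_right (hc t ht) zero_le_one)
  let e (ε t : ℝ) := ε * Real.exp ((c + 1) * t)
  have he : ∀ ε t, HasDerivAt (e ε) ((c + 1) * e ε t) t := fun ε t => by
    convert! ((((hasDerivAt_id t).const_mul (c + 1)).exp).const_mul ε) using 1
    simp only [e, id]
    ring
  -- The perturbation `e ε t • 1` grows fast enough to make the differential inequality strict.
  have hpert : ∀ ε > 0, ∀ t ∈ Icc 0 T, (Z t + e ε t • 1).PosDef := fun ε hε => by
    have hpos : ∀ t, 0 < e ε t := fun t => by positivity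
    refine posDef_of_lyap_add_smul_one_le_deriv (S := S) (K := K) (fun t _ => hpos t)
      (fun t ht => (hherm t ht).add (hone.smul (IsSelfAdjoint.all _)))
      (posDef_of_le (Matrix.PosDef.one.smul (hpos 0)) (le_add_of_nonneg_left h0))
      (fun t ht => (hZ t ht).add ((he ε t).hasDerivWithinAt.smul_const _)) fun t ht => ?_
    calc S.lyap (K t) (Z t + e ε t • 1) + e ε t • 1
        = S.lyap (K t) (Z t) + e ε t • S.lyap (K t) 1 + e ε t • 1 := by rw [map_add, map_smul]
      _ ≤ Z' t + e ε t • c • 1 + e ε t • 1 := add_le_add_left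
          (add_le_add (hle t ht) (smul_le_smul_of_nonneg_left (hlyap t ht) (hpos t).le)) _
      _ = Z' t + ((c + 1) * e ε t) • 1 := by module
  intro t ht
  have hlim : Tendsto (fun ε => Z t + e ε t • (1 : Matrix _ _ ℝ)) (𝓝[>] 0) (𝓝 (Z t)) :=
    tendsto_nhdsWithin_of_tendsto_nhds (Continuous.tendsto' (by fun_prop) _ _ (by simp [e]))
  exact ge_of_tendsto hlim (eventually_nhdsWithin_of_forall fun ε hε =>
    Matrix.nonneg_iff_posSemidef.2 (hpert ε hε t ht).posSemidef)

variable (hS : S.weight.PosDef)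
include hS

theorem le_of_deriv_le_phi_of_phi_le_deriv {T : ℝ} {U U' V V' : ℝ → Matrix (Fin n) (Fin n) ℝ}
    (hU0 : ∀ t ∈ Icc 0 T, 0 ≤ U t) (hV0 : ∀ t ∈ Icc 0 T, 0 ≤ V t)
    (hU : ∀ t ∈ Icc 0 T, HasDerivWithinAt U (U' t) (Icc 0 T) t)
    (hV : ∀ t ∈ Icc 0 T, HasDerivWithinAt V (V' t) (Icc 0 T) t)
    (hUφ : ∀ t ∈ Icc 0 T, U' t ≤ S.phi (U t)) (hVφ : ∀ t ∈ Icc 0 T, S.phi (V t) ≤ V' t)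
    (h0 : U 0 ≤ V 0) :
    ∀ t ∈ Icc 0 T, U t ≤ V t := by
  have hK : ContinuousOn (fun t => S.gain (V t)) (Icc 0 T) := fun t ht =>
    (contDiffAt_gain (m := 0) hS (hV0 t ht)).continuousAt.comp_continuousWithinAt
      (hV t ht).continuousWithinAt
  simp only [← sub_nonneg (b := U _)]
  refine nonneg_of_lyap_le_deriv (S := S) hK
    (fun t ht => (IsSelfAdjoint.of_nonneg (hV0 t ht)).sub (.of_nonneg (hU0 t ht)))
    (sub_nonneg.2 h0) (fun t ht => (hV t ht).sub (hU t ht)) fun t ht => ?_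
  calc S.lyap (S.gain (V t)) (V t - U t)
      = S.lyap (S.gain (V t)) (V t) + S.cost (S.gain (V t)) -
          (S.lyap (S.gain (V t)) (U t) + S.cost (S.gain (V t))) := by rw [map_sub]; abel
    _ ≤ S.phi (V t) - S.phi (U t) := by
        rw [← phi_eq_lyap_gain_add_cost hS (hV0 t ht)]
        exact sub_le_sub_left (phi_le_lyap_add_cost hS (hU0 t ht) _) _
    _ ≤ V' t - U' t := sub_le_sub (hVφ t ht) (hUφ t ht)

theorem eq_of_deriv_eq_phi {T : ℝ} {X Y : ℝ → Matrix (Fin n) (Fin n) ℝ}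
    (hX0 : ∀ t ∈ Icc 0 T, 0 ≤ X t) (hY0 : ∀ t ∈ Icc 0 T, 0 ≤ Y t)
    (hX : ∀ t ∈ Icc 0 T, HasDerivWithinAt X (S.phi (X t)) (Icc 0 T) t)
    (hY : ∀ t ∈ Icc 0 T, HasDerivWithinAt Y (S.phi (Y t)) (Icc 0 T) t) (h0 : X 0 = Y 0) :
    EqOn X Y (Icc 0 T) := fun t ht =>
  le_antisymm
    (le_of_deriv_le_phi_of_phi_le_deriv hS hX0 hY0 hX hY (fun _ _ => le_rfl) (fun _ _ => le_rfl)
      h0.le t ht)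
    (le_of_deriv_le_phi_of_phi_le_deriv hS hY0 hX0 hY hX (fun _ _ => le_rfl) (fun _ _ => le_rfl)
      h0.ge t ht)

theorem mem_Icc_of_deriv_eq_phi {T : ℝ} {P₁ P₂ : Matrix (Fin n) (Fin n) ℝ}
    {X : ℝ → Matrix (Fin n) (Fin n) ℝ} (hP₁ : 0 ≤ P₁) (hφ₁ : 0 ≤ S.phi P₁) (hφ₂ : S.phi P₂ ≤ 0)
    (hX0 : ∀ t ∈ Icc 0 T, 0 ≤ X t)
    (hX : ∀ t ∈ Icc 0 T, HasDerivWithinAt X (S.phi (X t)) (Icc 0 T) t) (h0 : X 0 ∈ Icc P₁ P₂) :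
    MapsTo X (Icc 0 T) (Icc P₁ P₂) := fun t ht =>
  ⟨le_of_deriv_le_phi_of_phi_le_deriv hS (fun _ _ => hP₁) hX0
      (fun s _ => hasDerivWithinAt_const s _ P₁) hX (fun _ _ => hφ₁) (fun _ _ => le_rfl) h0.1 t ht,
    le_of_deriv_le_phi_of_phi_le_deriv hS hX0 (fun _ _ => hP₁.trans (h0.1.trans h0.2)) hX
      (fun s _ => hasDerivWithinAt_const s _ P₂) (fun _ _ => le_rfl) (fun _ _ => hφ₂) h0.2 t ht⟩

end Coeffs

section InvariantCompact

variable {E : Type*} [NormedAddCommGroup E] [NormedSpace ℝ E]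

open scoped Manifold in
theorem exists_hasDerivAt_of_hasCompactSupport [CompleteSpace E] {g : E → E} (hg : ContDiff ℝ 1 g)
    (hsupp : HasCompactSupport g) (x₀ : E) :
    ∃ X : ℝ → E, X 0 = x₀ ∧ ∀ t, HasDerivAt X (g (X t)) t := by
  obtain ⟨K, hK⟩ := hg.lipschitzWith_of_hasCompactSupport hsupp one_ne_zero
  obtain ⟨L, hL⟩ := hsupp.exists_bound_of_continuous hg.continuous
  have hlocal (x : E) : ∃ γ : ℝ → E, γ 0 = x ∧
      IsMIntegralCurveOn (I := 𝓘(ℝ, E)) γ g (Ioo (-1) 1) := by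
    let t₀ : Icc (-1 : ℝ) 1 := ⟨0, by norm_num⟩
    have hPL : IsPicardLindelof (fun _ => g) t₀ x L.toNNReal 0 L.toNNReal K :=
      .of_time_independent (fun y _ => (hL y).trans (Real.le_coe_toNNReal L)) hK.lipschitzOnWith
        (by simp [t₀])
    obtain ⟨γ, hγ₀, hγ⟩ := hPL.exists_eq_forall_mem_Icc_hasDerivWithinAt₀
    exact ⟨γ, hγ₀, fun t ht =>
      ((hγ t (Ioo_subset_Icc_self ht)).mono Ioo_subset_Icc_self).hasFDerivWithinAt
        |>.hasMFDerivWithinAt⟩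
  obtain ⟨X, hX₀, hX⟩ := exists_isMIntegralCurve_of_isMIntegralCurveOn
    (contMDiff_vectorSpace_iff_contDiff.2 hg) one_pos hlocal x₀
  exact ⟨X, hX₀, fun t => hasDerivAt_iff_hasFDerivAt.2 (hX t).hasFDerivAt⟩

variable [FiniteDimensional ℝ E] {f : E → E} {U K : Set E}

open scoped Manifold in
theorem exists_contDiff_hasCompactSupport_eventuallyEq (hU : IsOpen U) (hf : ContDiffOn ℝ 1 f U)
    (hK : IsCompact K) (hKU : K ⊆ U) :
    ∃ g : E → E, ContDiff ℝ 1 g ∧ HasCompactSupport g ∧ g =ᶠ[𝓝ˢ K] f := by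
  obtain ⟨L, hL, hKL, hLU⟩ := exists_compact_between hK hU hKU
  obtain ⟨ρ, hρK, hρL, -⟩ :=
    exists_contMDiffMap_one_nhds_of_subset_interior 𝓘(ℝ, E) (n := 1) hK.isClosed hKL
  have hρ : ContDiff ℝ 1 ρ := contMDiff_iff_contDiff.1 ρ.contMDiff
  have hzero (x : E) (hx : x ∉ L) : ρ x • f x = 0 := by rw [hρL x hx, zero_smul]
  refine ⟨fun x => ρ x • f x, contDiff_iff_contDiffAt.2 fun x => ?_, .intro hL hzero, ?_⟩
  · by_cases hx : x ∈ L
    · exact hρ.contDiffAt.smul (hf.contDiffAt (hU.mem_nhds (hLU hx)))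
    · exact contDiffAt_const.congr_of_eventuallyEq
        ((hL.isClosed.isOpen_compl.eventually_mem hx).mono hzero)
  · exact hρK.mono fun x hx => by simp only [hx, one_smul]

theorem exists_forall_mem_hasDerivWithinAt_of_invariant (hU : IsOpen U) (hf : ContDiffOn ℝ 1 f U)
    (hK : IsCompact K) (hKU : K ⊆ U)
    (hinv : ∀ (T : ℝ) (X : ℝ → E), (∀ t ∈ Icc 0 T, X t ∈ U) →
      (∀ t ∈ Icc 0 T, HasDerivWithinAt X (f (X t)) (Icc 0 T) t) → X 0 ∈ K →
      MapsTo X (Icc 0 T) K)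
    {x₀ : E} (hx₀ : x₀ ∈ K) :
    ∃ X : ℝ → E, X 0 = x₀ ∧
      ∀ t, 0 ≤ t → X t ∈ K ∧ HasDerivWithinAt X (f (X t)) (Ici 0) t := by
  obtain ⟨g, hg, hgsupp, hgf⟩ := exists_contDiff_hasCompactSupport_eventuallyEq hU hf hK hKU
  obtain ⟨X, hX₀, hX⟩ := exists_hasDerivAt_of_hasCompactSupport hg hgsupp x₀
  have hXcont : Continuous X := continuous_iff_continuousAt.2 fun t => (hX t).continuousAt
  set V : Set E := interior {x | x ∈ U ∧ g x = f x}
  have hKV : K ⊆ V :=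
    subset_interior_iff_mem_nhdsSet.2 (inter_mem (hU.mem_nhdsSet.2 hKU) hgf)
  have hVK (T : ℝ) (hT : MapsTo X (Icc 0 T) V) : MapsTo X (Icc 0 T) K := by
    refine hinv T X (fun t ht => (interior_subset (hT ht)).1) (fun t ht => ?_) (hX₀ ▸ hx₀)
    rw [← (interior_subset (hT ht)).2]
    exact (hX t).hasDerivWithinAt
  have hmem (T : ℝ) (hT : 0 ≤ T) : X T ∈ K := by
    refine (IsClosed.Icc_subset_of_forall_mem_nhdsGT_of_Icc_subset (s := X ⁻¹' K)
      ((hK.isClosed.preimage hXcont).inter isClosed_Icc) (hX₀ ▸ hx₀ : X 0 ∈ K) ?_)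
      (right_mem_Icc.2 hT)
    intro t ht hts
    have hV : X ⁻¹' V ∈ 𝓝[>] t := nhdsWithin_le_nhds <|
      (isOpen_interior.preimage hXcont).mem_nhds (hKV (hts (right_mem_Icc.2 ht.1)))
    obtain ⟨b, hb, htb⟩ := mem_nhdsGT_iff_exists_Ioo_subset.1 hV
    refine mem_of_superset (Ioo_mem_nhdsGT hb) fun u hu => hVK u (fun v hv => ?_)
      (right_mem_Icc.2 (ht.1.trans hu.1.le))
    rcases le_or_gt v t with hvt | htv
    · exact hKV (hts ⟨hv.1, hvt⟩)
    · exact htb ⟨htv, hv.2.trans_lt hu.2⟩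
  refine ⟨X, hX₀, fun t ht => ⟨hmem t ht, ?_⟩⟩
  rw [← (interior_subset (hKV (hmem t ht))).2]
  exact (hX t).hasDerivWithinAt

end InvariantCompact

namespace Coeffs

variable {n k : ℕ} {S : Coeffs n k} {P P₁ P₂ : Matrix (Fin n) (Fin n) ℝ}
  {X : ℝ → Matrix (Fin n) (Fin n) ℝ}

theorem isSolution_top_iff :
    S.IsSolution P ⊤ X ↔
      X 0 = P ∧ ∀ t, 0 ≤ t → (X t).PosDef ∧ HasDerivWithinAt X (S.phi (X t)) (Ici 0) t := by
  simp only [IsSolution, EReal.coe_lt_top, forall_const]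

theorem isSolution_const_of_phi_eq_zero (hP : P.PosDef) (hφ : S.phi P = 0) :
    S.IsSolution P ⊤ fun _ => P :=
  isSolution_top_iff.2 ⟨rfl, fun t _ => ⟨hP, hφ ▸ hasDerivWithinAt_const t _ P⟩⟩

variable (hS : S.weight.PosDef)
include hS

theorem isTrajectory_of_isSolution_top (hX : S.IsSolution P ⊤ X) : S.IsTrajectory P X := by
  refine ⟨hX, fun T Y hY t ht htT => ?_⟩
  have hX' := (isSolution_top_iff.1 hX).2
  have hY' (s : ℝ) (hs : s ∈ Icc 0 t) := hY.2 s hs.1 ((EReal.coe_le_coe_iff.2 hs.2).trans_lt htT)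
  exact eq_of_deriv_eq_phi hS (fun s hs => (hY' s hs).1.posSemidef.nonneg)
    (fun s hs => (hX' s hs.1).1.posSemidef.nonneg)
    (fun s hs => (hY' s hs).2.mono Icc_subset_Ici_self)
    (fun s hs => (hX' s hs.1).2.mono Icc_subset_Ici_self)
    (hY.1.trans hX.1.symm) (right_mem_Icc.2 ht)

theorem isHermitian_of_deriv_eq_phi_symmPart {T : ℝ}
    (hX0 : ∀ t ∈ Icc 0 T, (symmPart (X t)).PosDef)
    (hX : ∀ t ∈ Icc 0 T, HasDerivWithinAt X (S.phi (symmPart (X t))) (Icc 0 T) t)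
    (h0 : (X 0).IsHermitian) :
    ∀ t ∈ Icc 0 T, (X t).IsHermitian := by
  have hderiv (t : ℝ) (ht : t ∈ Icc 0 T) :
      HasDerivWithinAt (fun s => star (X s) - X s) 0 (Icc 0 T) t := by
    have hφ : star (S.phi (symmPart (X t))) = S.phi (symmPart (X t)) :=
      isHermitian_phi hS (hX0 t ht).1
    simpa only [hφ, sub_self] using (hX t ht).star.fun_sub (hX t ht)
  intro t ht
  have hconst := constant_of_derivWithin_zero
    (fun s hs => (hderiv s hs).differentiableWithinAt)
    (fun s hs => (hderiv s (Ico_subset_Icc_self hs)).derivWithin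
      (uniqueDiffOn_Icc (hs.1.trans_lt hs.2) s (Ico_subset_Icc_self hs))) t ht
  rw [sub_eq_zero.2 h0.star_eq] at hconst
  exact sub_eq_zero.1 hconst

theorem exists_isTrajectory_mem_Icc (hP₁ : P₁.PosDef) (hφ₁ : 0 ≤ S.phi P₁) (hφ₂ : S.phi P₂ ≤ 0)
    (hP : P ∈ Icc P₁ P₂) :
    ∃ X, S.IsTrajectory P X ∧ ∀ t, 0 ≤ t → X t ∈ Icc P₁ P₂ := by
  have hpos {Y} (hY : Y ∈ Icc P₁ P₂) : Y.PosDef := posDef_of_le hP₁ hY.1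
  have hsymm {Y} (hY : Y ∈ Icc P₁ P₂) : symmPart Y = Y := symmPart_eq_self (hpos hY).1
  have hsmooth : ContDiffOn ℝ 1 (fun Y => S.phi (symmPart Y)) {Y | (symmPart Y).PosDef} :=
    fun Y hY => ((contDiffAt_phi hS hY.posSemidef.nonneg).comp Y
      contDiff_symmPart.contDiffAt).contDiffWithinAt
  have hinv (T : ℝ) (X : ℝ → Matrix (Fin n) (Fin n) ℝ)
      (hXU : ∀ t ∈ Icc 0 T, (symmPart (X t)).PosDef)
      (hX : ∀ t ∈ Icc 0 T, HasDerivWithinAt X (S.phi (symmPart (X t))) (Icc 0 T) t)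
      (h0 : X 0 ∈ Icc P₁ P₂) : MapsTo X (Icc 0 T) (Icc P₁ P₂) := by
    have hXsymm (t : ℝ) (ht : t ∈ Icc 0 T) : symmPart (X t) = X t :=
      symmPart_eq_self (isHermitian_of_deriv_eq_phi_symmPart hS hXU hX (hpos h0).1 t ht)
    exact mem_Icc_of_deriv_eq_phi hS hP₁.posSemidef.nonneg hφ₁ hφ₂
      (fun t ht => hXsymm t ht ▸ (hXU t ht).posSemidef.nonneg)
      (fun t ht => by simpa only [hXsymm t ht] using hX t ht) h0
  obtain ⟨X, hX0, hX⟩ := exists_forall_mem_hasDerivWithinAt_of_invariant isOpen_posDef_symmPart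
    hsmooth isCompact_Icc (fun Y hY => by simpa only [mem_ofPred, hsymm hY] using hpos hY) hinv hP
  refine ⟨X, isTrajectory_of_isSolution_top hS (isSolution_top_iff.2 ⟨hX0, fun t ht => ?_⟩),
    fun t ht => (hX t ht).1⟩
  obtain ⟨hmem, hderiv⟩ := hX t ht
  exact ⟨hpos hmem, by simpa only [hsymm hmem] using hderiv⟩

theorem antitoneOn_of_isSolution_top (hX : S.IsSolution P ⊤ X) (hφ : S.phi P ≤ 0) :
    AntitoneOn X (Ici 0) := by
  obtain ⟨rfl, hX'⟩ := isSolution_top_iff.1 hX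
  have hnonneg (t : ℝ) (ht : 0 ≤ t) : 0 ≤ X t := (hX' t ht).1.posSemidef.nonneg
  have hderiv (t T : ℝ) (ht : t ∈ Icc 0 T) : HasDerivWithinAt X (S.phi (X t)) (Icc 0 T) t :=
    (hX' t ht.1).2.mono Icc_subset_Ici_self
  have hle (s : ℝ) (hs : 0 ≤ s) : X s ≤ X 0 :=
    le_of_deriv_le_phi_of_phi_le_deriv hS (fun t ht => hnonneg t ht.1)
      (fun _ _ => hnonneg 0 le_rfl) (hderiv · s)
      (fun t _ => hasDerivWithinAt_const t _ (X 0)) (fun _ _ => le_rfl) (fun _ _ => hφ) le_rfl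
      s (right_mem_Icc.2 hs)
  intro t ht u _ htu
  have hshift (s : ℝ) (hs : s ∈ Icc 0 t) :
      HasDerivWithinAt (fun s => X (s + (u - t))) (S.phi (X (s + (u - t)))) (Icc 0 t) s := by
    have hmaps : MapsTo (· + (u - t)) (Icc 0 t) (Ici 0) :=
      fun r hr => add_nonneg hr.1 (sub_nonneg.2 htu)
    simpa only [one_smul, Function.comp_def, id] using (hX' _ (hmaps hs)).2.scomp s
      ((hasDerivAt_id s).add_const (u - t)).hasDerivWithinAt hmaps
  have hcompare := le_of_deriv_le_phi_of_phi_le_deriv hS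
    (fun s hs => hnonneg _ (add_nonneg hs.1 (sub_nonneg.2 htu))) (fun s hs => hnonneg s hs.1)
    hshift (hderiv · t) (fun _ _ => le_rfl) (fun _ _ => le_rfl)
    (by simpa only [zero_add] using hle (u - t) (sub_nonneg.2 htu)) t (right_mem_Icc.2 ht)
  simpa only [add_sub_cancel] using hcompare

theorem phi_nonpos_of_isSolution_top (hX : S.IsSolution P ⊤ X) (hφ : S.phi P ≤ 0) {t : ℝ}
    (ht : 0 ≤ t) : S.phi (X t) ≤ 0 := by
  have hanti := antitoneOn_of_isSolution_top hS hX hφ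
  have hslope := (hasDerivWithinAt_iff_tendsto_slope' self_notMem_Ioi).1
    (((isSolution_top_iff.1 hX).2 t ht).2.mono (Ioi_subset_Ici ht))
  refine le_of_tendsto hslope (eventually_nhdsWithin_of_forall fun s hs => ?_)
  have hts : t ≤ s := le_of_lt hs
  exact smul_nonpos_of_nonneg_of_nonpos (inv_nonneg.2 (sub_nonneg.2 hts))
    (sub_nonpos.2 (hanti ht (ht.trans hts) hts))

theorem exists_pos_le_one_phi_smul_nonneg (hP : P.PosDef) :
    ∃ a : ℝ, 0 < a ∧ a ≤ 1 ∧ 0 ≤ S.phi (a • P) := by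
  obtain ⟨c, hc, hle⟩ := exists_pos_le_smul (isHermitian_phi hS hP.1).neg (posDef_schur hS)
  have ha : (1 + c)⁻¹ ≤ 1 := inv_le_one_of_one_le₀ (by linarith)
  refine ⟨(1 + c)⁻¹, by positivity, ha, ?_⟩
  calc 0 ≤ (1 + c)⁻¹ • (c • S.schur - -S.phi P) :=
        smul_nonneg (by positivity) (sub_nonneg.2 hle)
    _ = (1 + c)⁻¹ • S.phi P + (1 - (1 + c)⁻¹) • S.schur := by
        rw [show 1 - (1 + c)⁻¹ = (1 + c)⁻¹ * c by field_simp; ring]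
        module
    _ ≤ S.phi ((1 + c)⁻¹ • P) :=
        smul_phi_add_smul_schur_le hS hP.posSemidef.nonneg (by positivity) ha

theorem isCompact_Icc_inter_phi_nonpos (hP₁ : 0 ≤ P₁) :
    IsCompact (Icc P₁ P₂ ∩ S.phi ⁻¹' Iic 0) := by
  have hcont : ContinuousOn S.phi (Icc P₁ P₂) := fun X hX =>
    (contDiffAt_phi (m := 0) hS (hP₁.trans hX.1)).continuousAt.continuousWithinAt
  exact isCompact_Icc.of_isClosed_subset
    (hcont.preimage_isClosed_of_isClosed isClosed_Icc isClosed_Iic) inter_subset_left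

theorem phi_eq_zero_of_isMinOn_trace (hP₁ : P₁.PosDef) (hφ₁ : 0 ≤ S.phi P₁) (hP : P₁ ≤ P)
    (hφ : S.phi P ≤ 0) (hmin : IsMinOn Matrix.trace (Icc P₁ P ∩ S.phi ⁻¹' Iic 0) P) :
    S.phi P = 0 := by
  obtain ⟨X, hX, hmem⟩ := exists_isTrajectory_mem_Icc hS hP₁ hφ₁ hφ ⟨hP, le_rfl⟩
  have hconst (t : ℝ) (ht : t ∈ Ici 0) : X t = P := by
    have htrace : P.trace ≤ (X t).trace :=
      hmin ⟨hmem t ht, phi_nonpos_of_isSolution_top hS hX.1 hφ ht⟩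
    have hpsd : (P - X t).PosSemidef := Matrix.le_iff.1 (hmem t ht).2
    have hzero : (P - X t).trace = 0 :=
      le_antisymm (by rw [Matrix.trace_sub]; linarith) hpsd.trace_nonneg
    exact (sub_eq_zero.1 (hpsd.trace_eq_zero_iff.1 hzero)).symm
  have hderiv := ((isSolution_top_iff.1 hX.1).2 0 le_rfl).2
  rw [hX.1.1] at hderiv
  exact (uniqueDiffOn_Ici 0 0 self_mem_Ici).eq_deriv _ hderiv
    ((hasDerivWithinAt_const _ _ P).congr hconst hX.1.1)

theorem exists_posDef_phi_eq_zero (hP : P.PosDef) (hφ : S.phi P ≤ 0) :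
    ∃ Pbar : Matrix (Fin n) (Fin n) ℝ, Pbar.PosDef ∧ S.phi Pbar = 0 := by
  obtain ⟨a, ha, ha1, hφa⟩ := exists_pos_le_one_phi_smul_nonneg hS hP
  have haP : (a • P).PosDef := hP.smul ha
  have hle : a • P ≤ P := by
    simpa only [one_smul] using smul_le_smul_of_nonneg_right ha1 hP.posSemidef.nonneg
  obtain ⟨Pbar, ⟨hPbar, hφbar⟩, hmin⟩ :=
    (isCompact_Icc_inter_phi_nonpos hS haP.posSemidef.nonneg).exists_isMinOn
      ⟨P, ⟨hle, le_rfl⟩, hφ⟩ (f := Matrix.trace) (by fun_prop)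
  refine ⟨Pbar, posDef_of_le haP hPbar.1,
    phi_eq_zero_of_isMinOn_trace hS haP hφa hPbar.1 hφbar (hmin.on_subset ?_)⟩
  exact inter_subset_inter_left _ (Icc_subset_Icc_right hPbar.2)

theorem exists_gare_iff :
    (∃ Pbar : Matrix (Fin n) (Fin n) ℝ, Pbar.PosDef ∧ S.GARE Pbar) ↔
      ∃ P₀ : Matrix (Fin n) (Fin n) ℝ, P₀.PosDef ∧ LoewnerLE (S.phi P₀) 0 := by
  constructor
  · rintro ⟨Pbar, hPbar, hφ, -⟩
    exact ⟨Pbar, hPbar, Matrix.le_iff.1 hφ.le⟩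
  · rintro ⟨P₀, hP₀, hφ⟩
    obtain ⟨Pbar, hPbar, hφbar⟩ := exists_posDef_phi_eq_zero hS hP₀ (Matrix.le_iff.2 hφ)
    exact ⟨Pbar, hPbar, hφbar, posDef_denom hS hPbar.posSemidef.nonneg⟩

end Coeffs

section ThompsonMetric

variable {n : ℕ} {X Y : Matrix (Fin n) (Fin n) ℝ}

theorem nonempty_of_matrix_ne (h : X ≠ Y) : Nonempty (Fin n) :=
  not_isEmpty_iff.1 fun _ => h (Subsingleton.elim X Y)

theorem exp_neg_smul_le_iff {l : ℝ} : Real.exp (-l) • Y ≤ X ↔ Y ≤ Real.exp l • X := by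
  rw [Real.exp_neg, inv_smul_le_iff_of_pos (Real.exp_pos l)]

variable [Nonempty (Fin n)]

theorem pos_of_posDef (hX : X.PosDef) : 0 < X :=
  hX.posSemidef.nonneg.lt_of_ne' hX.isStrictlyPositive.isUnit.ne_zero

theorem smul_le_smul_iff_of_posDef (hY : Y.PosDef) {s t : ℝ} : s • Y ≤ t • Y ↔ s ≤ t :=
  smul_le_smul_iff_of_pos_right (pos_of_posDef hY)

theorem pos_of_posDef_of_le_smul (hX : X.PosDef) (hY : Y.PosDef) {t : ℝ} (h : X ≤ t • Y) :
    0 < t :=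
  pos_of_smul_pos_right ((pos_of_posDef hX).trans_le h) (pos_of_posDef hY).le

theorem isLeast_bigM (hX : X.PosDef) (hY : Y.PosDef) :
    IsLeast {t : ℝ | X ≤ t • Y} (bigM X Y) := by
  have hclosed : IsClosed {t : ℝ | X ≤ t • Y} := isClosed_le continuous_const (by fun_prop)
  obtain ⟨t, -, ht⟩ := exists_pos_le_smul hX.1 hY
  exact hclosed.isLeast_csInf ⟨t, ht⟩ ⟨0, fun s hs => (pos_of_posDef_of_le_smul hX hY hs).le⟩

theorem isGreatest_smallM (hX : X.PosDef) (hY : Y.PosDef) :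
    IsGreatest {t : ℝ | t • Y ≤ X} (smallM X Y) := by
  have hclosed : IsClosed {t : ℝ | t • Y ≤ X} := isClosed_le (by fun_prop) continuous_const
  obtain ⟨t, -, ht⟩ := exists_pos_le_smul hX.1 hY
  refine hclosed.isGreatest_csSup ⟨0, by simpa using hX.posSemidef.nonneg⟩ ⟨t, fun s hs => ?_⟩
  exact (smul_le_smul_iff_of_posDef hY).1 (le_trans hs ht)

theorem smallM_pos (hX : X.PosDef) (hY : Y.PosDef) : 0 < smallM X Y := by
  obtain ⟨t, ht, hle⟩ := exists_pos_le_smul hY.1 hX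
  exact (inv_pos.2 ht).trans_le
    ((isGreatest_smallM hX hY).2 ((inv_smul_le_iff_of_pos ht).2 hle))

theorem bigM_le_iff (hX : X.PosDef) (hY : Y.PosDef) {t : ℝ} : bigM X Y ≤ t ↔ X ≤ t • Y :=
  ⟨fun h => (isLeast_bigM hX hY).1.trans ((smul_le_smul_iff_of_posDef hY).2 h),
    fun h => (isLeast_bigM hX hY).2 h⟩

theorem dT_le_iff (hX : X.PosDef) (hY : Y.PosDef) {l : ℝ} :
    dT X Y ≤ l ↔ X ∈ Icc (Real.exp (-l) • Y) (Real.exp l • Y) := by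
  have hpos : 0 < bigM X Y := pos_of_posDef_of_le_smul hX hY (isLeast_bigM hX hY).1
  rw [dT, Real.log_le_iff_le_exp (lt_max_of_lt_left hpos), max_le_iff, bigM_le_iff hX hY,
    bigM_le_iff hY hX, mem_Icc, exp_neg_smul_le_iff, and_comm]

theorem dT_nonneg (hX : X.PosDef) (hY : Y.PosDef) : 0 ≤ dT X Y := by
  obtain ⟨hlower, hupper⟩ := (dT_le_iff hX hY).1 le_rfl
  have := Real.exp_le_exp.1 ((smul_le_smul_iff_of_posDef hY).1 (hlower.trans hupper))
  linarith

theorem dT_eq_zero_iff (hX : X.PosDef) (hY : Y.PosDef) : dT X Y = 0 ↔ X = Y := by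
  rw [← (dT_nonneg hX hY).ge_iff_eq', dT_le_iff hX hY, neg_zero, Real.exp_zero, one_smul, Icc_self,
    mem_singleton_iff]

omit [Nonempty (Fin n)] in
theorem dT_self (hX : X.PosDef) : dT X X = 0 := by
  cases isEmpty_or_nonempty (Fin n)
  · simp [dT, bigM, LoewnerLE, Subsingleton.elim _ (0 : Matrix (Fin n) (Fin n) ℝ),
      Matrix.PosSemidef.zero]
  · exact (dT_eq_zero_iff hX hX).2 rfl

omit [Nonempty (Fin n)] in
theorem dT_pos (hX : X.PosDef) (hY : Y.PosDef) (h : X ≠ Y) : 0 < dT X Y :=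
  have := nonempty_of_matrix_ne h
  (dT_nonneg hX hY).lt_of_ne' (mt (dT_eq_zero_iff hX hY).1 h)

end ThompsonMetric

theorem one_sub_exp_neg_mul_le (d : ℝ) {θ : ℝ} (h0 : 0 ≤ θ) (h1 : θ ≤ 1) :
    θ * (1 - Real.exp (-d)) ≤ 1 - Real.exp (-(d * θ)) := by
  have := convexOn_exp.2 (mem_univ 0) (mem_univ (-d)) (sub_nonneg.2 h1) h0 (by ring)
  simp only [smul_eq_mul, mul_zero, zero_add, Real.exp_zero] at this
  rw [show θ * -d = -(d * θ) by ring] at this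
  linarith

namespace Coeffs

variable {n k : ℕ} {S : Coeffs n k} {P Pbar : Matrix (Fin n) (Fin n) ℝ}

theorem rate_pos (hS : S.weight.PosDef) (hP : P.PosDef) (hPbar : Pbar.PosDef) (hne : P ≠ Pbar) :
    0 < S.rate P Pbar := by
  have := nonempty_of_matrix_ne hne
  have hd := dT_pos hP hPbar hne
  refine mul_pos (div_pos ?_ hd) (smallM_pos (posDef_schur hS) hPbar)
  rwa [sub_pos, Real.exp_lt_one_iff, neg_lt_zero]

theorem rate_mul_dT (hP : P.PosDef) (hPbar : Pbar.PosDef) (hne : P ≠ Pbar) :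
    S.rate P Pbar * dT P Pbar = (1 - Real.exp (-dT P Pbar)) * smallM S.schur Pbar := by
  have := (dT_pos hP hPbar hne).ne'
  rw [rate, schur]
  field_simp

variable (hS : S.weight.PosDef)
include hS

section Barrier

variable (hPbar : 0 ≤ Pbar) {m : ℝ} (hm : m • Pbar ≤ S.schur)
include hPbar hm

theorem smul_le_phi_smul (hφ : 0 ≤ S.phi Pbar) {a : ℝ} (h0 : 0 ≤ a) (h1 : a ≤ 1) :
    ((1 - a) * m) • Pbar ≤ S.phi (a • Pbar) :=
  calc ((1 - a) * m) • Pbar = (1 - a) • m • Pbar := mul_smul ..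
    _ ≤ (1 - a) • S.schur := smul_le_smul_of_nonneg_left hm (sub_nonneg.2 h1)
    _ ≤ a • S.phi Pbar + (1 - a) • S.schur := le_add_of_nonneg_left (smul_nonneg h0 hφ)
    _ ≤ S.phi (a • Pbar) := smul_phi_add_smul_schur_le hS hPbar h0 h1

theorem phi_smul_le_neg_smul (hφ : S.phi Pbar ≤ 0) {a : ℝ} (h1 : 1 ≤ a) :
    S.phi (a • Pbar) ≤ -((a - 1) * m) • Pbar :=
  calc S.phi (a • Pbar) ≤ a • S.phi Pbar - (a - 1) • S.schur :=
        phi_smul_le hS hPbar h1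
    _ ≤ 0 - (a - 1) • m • Pbar :=
        sub_le_sub (smul_nonpos_of_nonneg_of_nonpos (zero_le_one.trans h1) hφ)
          (smul_le_smul_of_nonneg_left hm (sub_nonneg.2 h1))
    _ = -((a - 1) * m) • Pbar := by rw [zero_sub, neg_smul, mul_smul]

variable {X : ℝ → Matrix (Fin n) (Fin n) ℝ} (hX : S.IsSolution P ⊤ X) {l l' : ℝ → ℝ}
  (hl : ∀ s, HasDerivAt l (l' s) s) (hl0 : ∀ s, 0 ≤ l s)
  (hl' : ∀ s, 0 ≤ s → -(1 - Real.exp (-l s)) * m ≤ l' s)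
include hX hl hl0 hl'

theorem le_exp_smul_of_isSolution_top (hφ : S.phi Pbar ≤ 0) (h0 : P ≤ Real.exp (l 0) • Pbar)
    {t : ℝ} (ht : 0 ≤ t) : X t ≤ Real.exp (l t) • Pbar := by
  obtain ⟨hX0, hXt⟩ := isSolution_top_iff.1 hX
  refine le_of_deriv_le_phi_of_phi_le_deriv hS (V := fun s => Real.exp (l s) • Pbar)
    (V' := fun s => (Real.exp (l s) * l' s) • Pbar)
    (fun s hs => (hXt s hs.1).1.posSemidef.nonneg)
    (fun s _ => smul_nonneg (Real.exp_pos _).le hPbar)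
    (fun s hs => (hXt s hs.1).2.mono Icc_subset_Ici_self)
    (fun s _ => (hl s).exp.hasDerivWithinAt.smul_const Pbar) (fun _ _ => le_rfl)
    (fun s hs => ?_) (hX0 ▸ h0) t (right_mem_Icc.2 ht)
  have hrate : -((Real.exp (l s) - 1) * m) ≤ Real.exp (l s) * l' s :=
    calc -((Real.exp (l s) - 1) * m)
        = Real.exp (l s) * (-(1 - Real.exp (-l s)) * m) := by
          rw [Real.exp_neg]
          field_simp
      _ ≤ Real.exp (l s) * l' s := mul_le_mul_of_nonneg_left (hl' s hs.1) (Real.exp_pos _).le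
  exact (phi_smul_le_neg_smul hS hPbar hm hφ (Real.one_le_exp (hl0 s))).trans
    (smul_le_smul_of_nonneg_right hrate hPbar)

theorem exp_neg_smul_le_of_isSolution_top (hφ : 0 ≤ S.phi Pbar) (hm0 : 0 ≤ m)
    (h0 : Real.exp (-l 0) • Pbar ≤ P) {t : ℝ} (ht : 0 ≤ t) : Real.exp (-l t) • Pbar ≤ X t := by
  obtain ⟨hX0, hXt⟩ := isSolution_top_iff.1 hX
  refine le_of_deriv_le_phi_of_phi_le_deriv hS (U := fun s => Real.exp (-l s) • Pbar)
    (U' := fun s => (Real.exp (-l s) * -l' s) • Pbar)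
    (fun s _ => smul_nonneg (Real.exp_pos _).le hPbar)
    (fun s hs => (hXt s hs.1).1.posSemidef.nonneg)
    (fun s _ => (hl s).fun_neg.exp.hasDerivWithinAt.smul_const Pbar)
    (fun s hs => (hXt s hs.1).2.mono Icc_subset_Ici_self)
    (fun s hs => ?_) (fun _ _ => le_rfl) (hX0 ▸ h0) t (right_mem_Icc.2 ht)
  have hexp : Real.exp (-l s) ≤ 1 := Real.exp_le_one_iff.2 (neg_nonpos.2 (hl0 s))
  have hrate : Real.exp (-l s) * -l' s ≤ (1 - Real.exp (-l s)) * m :=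
    calc Real.exp (-l s) * -l' s ≤ Real.exp (-l s) * ((1 - Real.exp (-l s)) * m) :=
          mul_le_mul_of_nonneg_left (by linarith [hl' s hs.1]) (Real.exp_pos _).le
      _ ≤ (1 - Real.exp (-l s)) * m :=
          mul_le_of_le_one_left (mul_nonneg (sub_nonneg.2 hexp) hm0) hexp
  exact (smul_le_smul_of_nonneg_right hrate hPbar).trans
    (smul_le_phi_smul hS hPbar hm hφ (Real.exp_pos _).le hexp)

end Barrier

variable (hPbar : Pbar.PosDef) (hφ : S.phi Pbar = 0)
include hPbar hφ

theorem exists_isTrajectory (hP : P.PosDef) : ∃ X, S.IsTrajectory P X := by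
  obtain ⟨c₁, hc₁, hle₁⟩ := exists_pos_le_smul hPbar.1 hP
  obtain ⟨c₂, -, hle₂⟩ := exists_pos_le_smul hP.1 hPbar
  have hPbar0 := hPbar.posSemidef.nonneg
  have hm : (0 : ℝ) • Pbar ≤ S.schur := by simpa using (posDef_schur hS).posSemidef.nonneg
  have ha0 : 0 < min 1 c₁⁻¹ := by positivity
  have hlower : 0 ≤ S.phi (min 1 c₁⁻¹ • Pbar) := by
    simpa using smul_le_phi_smul hS hPbar0 hm hφ.ge ha0.le (min_le_left _ _)
  have hupper : S.phi (max 1 c₂ • Pbar) ≤ 0 := by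
    simpa using phi_smul_le_neg_smul hS hPbar0 hm hφ.le (le_max_left 1 c₂)
  have hmem : P ∈ Icc (min 1 c₁⁻¹ • Pbar) (max 1 c₂ • Pbar) :=
    ⟨(smul_le_smul_of_nonneg_right (min_le_right _ _) hPbar0).trans
        ((inv_smul_le_iff_of_pos hc₁).2 hle₁),
      hle₂.trans (smul_le_smul_of_nonneg_right (le_max_right _ _) hPbar0)⟩
  obtain ⟨X, hX, -⟩ := exists_isTrajectory_mem_Icc hS (hPbar.smul ha0) hlower hupper hmem
  exact ⟨X, hX⟩

theorem dT_le_exp_rate_mul (hP : P.PosDef) (hne : P ≠ Pbar) {X : ℝ → Matrix (Fin n) (Fin n) ℝ}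
    (hX : S.IsSolution P ⊤ X) {t : ℝ} (ht : 0 ≤ t) :
    dT (X t) Pbar ≤ Real.exp (-S.rate P Pbar * t) * dT P Pbar := by
  have := nonempty_of_matrix_ne hne
  have hPbar0 := hPbar.posSemidef.nonneg
  have hα := rate_pos hS hP hPbar hne
  have hαd := rate_mul_dT (S := S) hP hPbar hne
  have hm0 := (smallM_pos (posDef_schur hS) hPbar).le
  have hm := (isGreatest_smallM (posDef_schur hS) hPbar).1
  obtain ⟨hPlower, hPupper⟩ := (dT_le_iff hP hPbar).1 le_rfl
  have hXt := (isSolution_top_iff.1 hX).2 t ht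
  set α := S.rate P Pbar
  set d := dT P Pbar
  set m := smallM S.schur Pbar
  let l (s : ℝ) : ℝ := d * Real.exp (-α * s)
  have hl (s : ℝ) : HasDerivAt l (d * (Real.exp (-α * s) * -α)) s := by
    simpa only [id, mul_one] using ((hasDerivAt_id s).const_mul (-α)).exp.const_mul d
  have hl0 (s : ℝ) : 0 ≤ l s := mul_nonneg (dT_nonneg hP hPbar) (Real.exp_pos _).le
  have hl' (s : ℝ) (hs : 0 ≤ s) : -(1 - Real.exp (-l s)) * m ≤ d * (Real.exp (-α * s) * -α) := by
    have hθ : Real.exp (-α * s) ≤ 1 := Real.exp_le_one_iff.2 (by nlinarith)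
    have := mul_le_mul_of_nonneg_right (one_sub_exp_neg_mul_le d (Real.exp_pos _).le hθ) hm0
    linear_combination this + Real.exp (-α * s) * hαd
  have hl_zero : l 0 = d := by simp [l]
  rw [mul_comm, dT_le_iff hXt.1 hPbar]
  exact ⟨exp_neg_smul_le_of_isSolution_top hS hPbar0 hm hX hl hl0 hl' hφ.ge hm0
      (hl_zero ▸ hPlower) ht,
    le_exp_smul_of_isSolution_top hS hPbar0 hm hX hl hl0 hl' hφ.le (hl_zero ▸ hPupper) ht⟩

theorem eq_of_phi_eq_zero (hP : P.PosDef) (hφP : S.phi P = 0) : P = Pbar := by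
  by_contra hne
  have hdecay := dT_le_exp_rate_mul hS hPbar hφ hP hne (isSolution_const_of_phi_eq_zero hP hφP)
    zero_le_one
  have hlt : Real.exp (-S.rate P Pbar * 1) < 1 :=
    Real.exp_lt_one_iff.2 (by linarith [rate_pos hS hP hPbar hne])
  exact hdecay.not_gt (mul_lt_of_lt_one_left (dT_pos hP hPbar hne) hlt)

theorem exists_dT_le_exp_mul (hP : P.PosDef) {X : ℝ → Matrix (Fin n) (Fin n) ℝ}
    (hX : S.IsTrajectory P X) :
    ∃ α : ℝ, 0 < α ∧ (P ≠ Pbar → 0 < S.rate P Pbar ∧ S.rate P Pbar ≤ α) ∧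
      ∀ t, 0 ≤ t → dT (X t) Pbar ≤ Real.exp (-α * t) * dT P Pbar := by
  rcases eq_or_ne P Pbar with rfl | hne
  · refine ⟨1, one_pos, fun h => absurd rfl h, fun t ht => ?_⟩
    rw [← hX.2 ⊤ _ (isSolution_const_of_phi_eq_zero hP hφ) t ht (EReal.coe_lt_top t), dT_self hP,
      mul_zero]
  · have hα := rate_pos hS hP hPbar hne
    exact ⟨S.rate P Pbar, hα, fun _ => ⟨hα, le_rfl⟩,
      fun t ht => dT_le_exp_rate_mul hS hPbar hφ hP hne hX.1 ht⟩

end Coeffs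

end

end GenRiccati

theorem mainTheorem4 (n k : ℕ) (S : GenRiccati.Coeffs n k) (hS : S.weight.PosDef) :
    ((∃ Pbar : Matrix (Fin n) (Fin n) ℝ, Pbar.PosDef ∧ S.GARE Pbar) ↔
      ∃ P0 : Matrix (Fin n) (Fin n) ℝ, P0.PosDef ∧ GenRiccati.LoewnerLE (S.phi P0) 0) ∧
    ∀ Pbar : Matrix (Fin n) (Fin n) ℝ, Pbar.PosDef → S.GARE Pbar →
      (∀ P : Matrix (Fin n) (Fin n) ℝ, P.PosDef → S.GARE P → P = Pbar) ∧
      ∀ P : Matrix (Fin n) (Fin n) ℝ, P.PosDef →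
        ∃ X : ℝ → Matrix (Fin n) (Fin n) ℝ, S.IsTrajectory P X ∧
          ∃ α : ℝ, 0 < α ∧ (P ≠ Pbar → 0 < S.rate P Pbar ∧ S.rate P Pbar ≤ α) ∧
            ∀ t : ℝ, 0 ≤ t →
              GenRiccati.dT (X t) Pbar ≤ Real.exp (-α * t) * GenRiccati.dT P Pbar := by
  refine ⟨GenRiccati.Coeffs.exists_gare_iff hS, fun Pbar hPbar ⟨hφ, _⟩ =>
    ⟨fun P hP ⟨hφP, _⟩ => ?_, fun P hP => ?_⟩⟩
  · exact GenRiccati.Coeffs.eq_of_phi_eq_zero hS hPbar hφ hP hφP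
  · obtain ⟨X, hX⟩ := GenRiccati.Coeffs.exists_isTrajectory hS hPbar hφ hP
    exact ⟨X, hX, GenRiccati.Coeffs.exists_dT_le_exp_mul hS hPbar hφ hP hX⟩
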